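/- Let $P$ be a poset, $\alpha$ an ordinal and $\varepsilon$ an ordinal with $\omega\le\varepsilon<\omega_1$. If $P^{\alpha}$ is $\varepsilon$-wqo, then $P^{<\alpha}$ is $\varepsilon$-wqo. Here the notions are as follows. For sequences $s:\beta\to P$ and $t:\delta\to P$ indexed by ordinals, $s\le t$ (embeddability) means that there is a strictly increasing map $\rho:\beta\to\delta$ with $s(\gamma)\le_P t(\rho(\gamma))$ for all $\gamma<\beta$. $P^{\alpha}$ is the poset obtained from the set of all $\alpha$-sequences from $P$, quasi-ordered by embeddability, by factoring by the equivalence relation $s\le t\wedge t\le s$; $P^{<\alpha}$ is obtained in the same way from the set of all sequences from $P$ of length $<\alpha$. A barrier is an infinite set $B$ of finite subsets of $\omega$ which is an antichain under inclusion and such that every infinite subset of $\bigcup B$ has an initial segment in $B$. A barrier is well ordered by the lexicographic order (of increasing enumerations), and its order type is taken with respect to that order. For finite $r,s\subseteq\omega$ with $r\ne\emptyset$, write $r\triangleleft s$ if $\min r<\min s$ and $r\setminus\{\min r\}$ is a proper initial segment of $s$. A poset $Q$ is $\varepsilon$-wqo if for every barrier $B$ of order type $\le\varepsilon$ and every map $f:B\to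 Q$ there are $s,t\in B$ with $s\triangleleft t$ and $f(s)\le_Q f(t)$. -/

import Mathlib

namespace BarrierWqo

open Set

universe u v

/-! ### Barriers -/

/-- The base of a family of finite sets of natural numbers is the union of its members. -/
def base (A : Set (Finset ℕ)) : Set ℕ := ⋃ s ∈ A, (s : Set ℕ)

/-- `s` is an initial segment of `X`: a subset of `X` which is closed downwards in `X`. -/
def IsInitialSegment (s : Finset ℕ) (X : Set ℕ) : Prop :=
  (s : Set ℕ) ⊆ X ∧ ∀ x ∈ X, ∀ y ∈ s, x ≤ y → x ∈ s

/-- A barrier is an infinite family of finite sets of natural numbers that is an antichain under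
inclusion and such that every infinite subset of its base has an initial segment in it. -/
structure IsBarrier (B : Set (Finset ℕ)) : Prop where
  infinite : B.Infinite
  antichain : ∀ s ∈ B, ∀ t ∈ B, s ⊆ t → s = t
  exists_initialSegment : ∀ X : Set ℕ, X ⊆ base B → X.Infinite → ∃ s ∈ B, IsInitialSegment s X

/-- The shift-extension relation `r ◁ s`: the least element of `r` is smaller than that of `s`, and
`r` without its least element is a proper initial segment of `s`. -/
def ShiftExt (r s : Finset ℕ) : Prop :=
  ∃ (hr : r.Nonempty) (hs : s.Nonempty), r.min' hr < s.min' hs ∧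
    IsInitialSegment (r.erase (r.min' hr)) s ∧ r.erase (r.min' hr) ≠ s

/-- The lexicographic order on finite sets of natural numbers, that is, the lexicographic order of
their increasing enumerations. -/
def LexLT (s t : Finset ℕ) : Prop := s.sort (· ≤ ·) < t.sort (· ≤ ·)

/-- The lexicographic order restricted to a family of finite sets. -/
def lexOn (B : Set (Finset ℕ)) (s t : B) : Prop := LexLT s t

theorem sort_lt_of_prefix {p l l' : List ℕ} {n m : ℕ} (hl : p ++ [n] <+: l)
    (hl' : p ++ [m] <+: l') (h : n < m) : l < l' := by
  obtain ⟨r, rfl⟩ := hl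
  obtain ⟨r', rfl⟩ := hl'
  rw [List.append_assoc, List.append_assoc]
  apply List.append_left_lt
  simp [List.cons_lt_cons_iff, h]

/-- A subset of a set of lists without a lexicographically least element can be refined to one
whose members share one more entry. -/
theorem exists_extend (S : Set (List ℕ)) (hS : S.Nonempty) (hmin : ∀ l ∈ S, ∃ l' ∈ S, l' < l)
    (p : List ℕ) (hp : ∀ l ∈ S, p <+: l) :
    ∃ n : ℕ, ∃ S' ⊆ S, S'.Nonempty ∧ (∀ l ∈ S', ∃ l' ∈ S', l' < l) ∧
      ∀ l ∈ S', p ++ [n] <+: l := by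
  classical
  have hpS : p ∉ S := by
    intro h
    obtain ⟨l', hl', hlt⟩ := hmin p h
    obtain ⟨r, rfl⟩ := hp l' hl'
    exact List.le_append_left hlt
  have hext : ∀ l ∈ S, ∃ n, p ++ [n] <+: l := by
    intro l hl
    obtain ⟨r, rfl⟩ := hp l hl
    cases r with
    | nil => exact absurd hl (by simpa using hpS)
    | cons a r => exact ⟨a, r, by simp⟩
  have hex : ∃ n, ∃ l ∈ S, p ++ [n] <+: l := by
    obtain ⟨l, hl⟩ := hS
    obtain ⟨n, hn⟩ := hext l hl
    exact ⟨n, l, hl, hn⟩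
  obtain ⟨l₀, hl₀, hn₀⟩ := Nat.find_spec hex
  refine ⟨Nat.find hex, {l ∈ S | p ++ [Nat.find hex] <+: l}, fun l hl => hl.1,
    ⟨l₀, hl₀, hn₀⟩, ?_, fun l hl => hl.2⟩
  rintro l ⟨hl, hpl⟩
  obtain ⟨l', hl', hlt⟩ := hmin l hl
  obtain ⟨m, hm⟩ := hext l' hl'
  refine ⟨l', ⟨hl', ?_⟩, hlt⟩
  rcases (Nat.find_min' hex ⟨l', hl', hm⟩).eq_or_lt with h | h
  · rwa [h]
  · exact absurd (sort_lt_of_prefix hpl hm h) (lt_asymm hlt)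

/-- The lexicographic order on a barrier has no infinite descending sequences. -/
theorem IsBarrier.wellFounded_lexOn {B : Set (Finset ℕ)} (hB : IsBarrier B) :
    WellFounded (lexOn B) := by
  classical
  rw [WellFounded.wellFounded_iff_has_min]
  by_contra hcon
  push Not at hcon
  obtain ⟨T, hT, hTmin⟩ := hcon
  let St := {q : List ℕ × Set (List ℕ) // q.2.Nonempty ∧ (∀ l ∈ q.2, ∃ l' ∈ q.2, l' < l) ∧
    (∀ l ∈ q.2, q.1 <+: l) ∧ ∀ l ∈ q.2, ∃ s ∈ B, s.sort (· ≤ ·) = l}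
  have step : ∀ q : St, ∃ q' : St, ∃ n, q'.1.1 = q.1.1 ++ [n] := by
    rintro ⟨⟨p, S⟩, h1, h2, h3, h4⟩
    obtain ⟨n, S', hsub, h1', h2', h3'⟩ := exists_extend S h1 h2 p h3
    exact ⟨⟨⟨p ++ [n], S'⟩, h1', h2', h3', fun l hl => h4 l (hsub hl)⟩, n, rfl⟩
  choose next x hx using step
  let q₀ : St := ⟨⟨[], {l | ∃ s ∈ T, (s : Finset ℕ).sort (· ≤ ·) = l}⟩, by
    obtain ⟨s, hs⟩ := hT
    exact ⟨_, s, hs, rfl⟩, by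
    rintro l ⟨s, hs, rfl⟩
    obtain ⟨t, ht, hlt⟩ := hTmin s hs
    exact ⟨_, ⟨t, ht, rfl⟩, hlt⟩, fun l _ => List.nil_prefix, by
    rintro l ⟨s, hs, rfl⟩
    exact ⟨s, s.2, rfl⟩⟩
  let q : ℕ → St := fun k => next^[k] q₀
  let a : ℕ → ℕ := fun k => x (q k)
  have hq : ∀ k, (q k).1.1 = (List.range k).map a := by
    intro k
    induction k with
    | zero => rfl
    | succ k ih =>
      have : q (k + 1) = next (q k) := Function.iterate_succ_apply' _ _ _
      rw [this, hx, ih, List.range_succ, List.map_append]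
      rfl
  have key : ∀ k, ∃ s ∈ B, (List.range k).map a <+: s.sort (· ≤ ·) := by
    intro k
    obtain ⟨⟨l, hl⟩, _, h3, h4⟩ := (q k).2
    obtain ⟨s, hs, rfl⟩ := h4 l hl
    exact ⟨s, hs, hq k ▸ h3 _ hl⟩
  have hmono : StrictMono a := by
    refine strictMono_nat_of_lt_succ fun k => ?_
    obtain ⟨s, hs, hpre⟩ := key (k + 2)
    have h := (s.sortedLT_sort).pairwise.sublist hpre.sublist
    rw [List.range_succ, List.range_succ] at h
    simp only [List.map_append, List.pairwise_append] at h
    exact h.2.2 (a k) (by simp) (a (k + 1)) (by simp)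
  obtain ⟨b, hbB, hb⟩ := hB.exists_initialSegment (Set.range a) (by
    rintro _ ⟨k, rfl⟩
    obtain ⟨s, hs, hpre⟩ := key (k + 1)
    have : a k ∈ s.sort (· ≤ ·) :=
      hpre.subset (List.mem_map.2 ⟨k, List.mem_range.2 (Nat.lt_succ_self k), rfl⟩)
    exact Set.mem_biUnion hs (by simpa using this))
    (Set.infinite_range_of_injective hmono.injective)
  obtain ⟨k, hk⟩ : ∃ k, ∀ y ∈ b, y < a k :=
    ⟨b.sup id + 1, fun y hy => (Nat.lt_succ_of_le (Finset.le_sup (f := id) hy)).trans_le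
      (hmono.le_apply)⟩
  have hall : ∀ l ∈ (q k).1.2, l = b.sort (· ≤ ·) := by
    intro l hl
    obtain ⟨s, hs, rfl⟩ := (q k).2.2.2.2 l hl
    have hpre := (q k).2.2.2.1 _ hl
    rw [hq k] at hpre
    rw [hB.antichain b hbB s hs ?_]
    intro y hy
    obtain ⟨j, rfl⟩ := hb.1 hy
    have hj : j < k := hmono.lt_iff_lt.1 (hk _ hy)
    simpa using hpre.subset (List.mem_map.2 ⟨j, List.mem_range.2 hj, rfl⟩)
  obtain ⟨l, hl⟩ := (q k).2.1
  obtain ⟨l', hl', hlt⟩ := (q k).2.2.1 l hl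
  rw [hall l hl, hall l' hl'] at hlt
  exact lt_irrefl _ hlt

/-- Barriers are well ordered by the lexicographic order. -/
theorem IsBarrier.isWellOrder {B : Set (Finset ℕ)} (hB : IsBarrier B) :
    IsWellOrder B (lexOn B) where
  wf := hB.wellFounded_lexOn
  trichotomous := fun s t h1 h2 => by
    have h : (s : Finset ℕ).sort (· ≤ ·) = (t : Finset ℕ).sort (· ≤ ·) :=
      le_antisymm (not_lt.1 h2) (not_lt.1 h1)
    apply Subtype.ext
    rw [← Finset.sort_toFinset (s : Finset ℕ) (· ≤ ·), h, Finset.sort_toFinset]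

/-- The type of a barrier is its order type under the lexicographic order. -/
noncomputable def IsBarrier.orderType {B : Set (Finset ℕ)} (hB : IsBarrier B) : Ordinal.{0} :=
  @Ordinal.type B (lexOn B) hB.isWellOrder

/-! ### Good barrier sequences and `ε`-wqo posets -/

/-- A barrier sequence `f : B → P` is good if `f s ≤ f t` for some `s ◁ t` in `B`. -/
def IsGood {P : Type u} [PartialOrder P] {B : Set (Finset ℕ)} (f : B → P) : Prop :=
  ∃ s t : B, ShiftExt s t ∧ f s ≤ f t

/-- `P` is `ε`-wqo if every map from a barrier of order type at most `ε` into `P` is good. -/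
def IsOrdinalWqo (ε : Ordinal.{0}) (P : Type u) [PartialOrder P] : Prop :=
  ∀ (B : Set (Finset ℕ)) (hB : IsBarrier B), hB.orderType ≤ ε → ∀ f : B → P, IsGood f

/-! ### The posets `P^α` and `P^{<α}` -/

/-- `s` embeds into `t`: there is a strictly increasing map `ρ` of the length of `s` into the length
of `t` such that `s γ ≤ t (ρ γ)` for all `γ`. -/
def Embeds {P : Type u} [PartialOrder P] {β δ : Ordinal.{v}} (s : Iio β → P) (t : Iio δ → P) :
    Prop :=
  ∃ ρ : Iio β → Iio δ, StrictMono ρ ∧ ∀ γ, s γ ≤ t (ρ γ)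

theorem Embeds.refl {P : Type u} [PartialOrder P] {β : Ordinal.{v}} (s : Iio β → P) :
    Embeds s s :=
  ⟨id, strictMono_id, fun _ => le_rfl⟩

theorem Embeds.trans {P : Type u} [PartialOrder P] {β δ η : Ordinal.{v}} {r : Iio β → P}
    {s : Iio δ → P} {t : Iio η → P} (h₁ : Embeds r s) (h₂ : Embeds s t) : Embeds r t := by
  obtain ⟨ρ, hρ, h⟩ := h₁
  obtain ⟨σ, hσ, k⟩ := h₂
  exact ⟨σ ∘ ρ, hσ.comp hρ, fun γ => (h γ).trans (k (ρ γ))⟩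

/-- The `α`-sequences from `P`. -/
structure OrdSeq (P : Type u) (α : Ordinal.{v}) where
  toFun : Iio α → P

/-- The sequences from `P` of length smaller than `α`. -/
structure OrdSeqLT (P : Type u) (α : Ordinal.{v}) where
  length : Ordinal.{v}
  length_lt : length < α
  toFun : Iio length → P

/-- The embeddability quasi-order on `α`-sequences. -/
instance (P : Type u) [PartialOrder P] (α : Ordinal.{v}) : Preorder (OrdSeq P α) where
  le s t := Embeds s.toFun t.toFun
  le_refl s := Embeds.refl s.toFun
  le_trans _ _ _ h₁ h₂ := Embeds.trans h₁ h₂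

/-- The embeddability quasi-order on sequences of length smaller than `α`. -/
instance (P : Type u) [PartialOrder P] (α : Ordinal.{v}) : Preorder (OrdSeqLT P α) where
  le s t := Embeds s.toFun t.toFun
  le_refl s := Embeds.refl s.toFun
  le_trans _ _ _ h₁ h₂ := Embeds.trans h₁ h₂

/-- The poset `P^α`: the quotient of the quasi-ordered set of `α`-sequences from `P`. -/
abbrev Power (P : Type u) [PartialOrder P] (α : Ordinal.{v}) : Type (max u (v + 1)) :=
  Antisymmetrization (OrdSeq P α) (· ≤ ·)

/-- The poset `P^{<α}`: the quotient of the quasi-ordered set of sequences from `P` of length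
smaller than `α`. -/
abbrev PowerLT (P : Type u) [PartialOrder P] (α : Ordinal.{v}) : Type (max u (v + 1)) :=
  Antisymmetrization (OrdSeqLT P α) (· ≤ ·)

end BarrierWqo

namespace BarrierWqo

open Set

universe u v w

/-! ### Fusion -/

/-! Suppose there is a bad barrier sequence in `P^{<α}`. Replace it by a bad `g` minimal for length
(`IsBarrier.exists_minimal_bad`): no barrier sequence of strictly shorter sequences below those of
`g` is bad on any further subbarrier. Constant sequences carry bad sequences in `P` to `P^α`, so `P`
is well founded, and some letter `b` is minimal among those occurring in the values of `g`. Pad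
every `g s` with `b` to length `α`. By hypothesis the padded sequence is not bad on any subbarrier,
so by Galvin's theorem (`IsBarrier.exists_bad_or_perfect`) it is perfect on one. For `s ◁ t` the
padded `g s` embeds although `g s` does not, so a tail of `g s` lies below `b`
(`OrdSeqLT.exists_tail_le`), hence is constantly `b`. Cutting these tails off gives shorter
sequences, which by minimality are perfect on a further subbarrier. If `s` has the shortest tail and
`s ◁ t`, then head embeds in head and tail in tail, so `g s ≤ g t`, a contradiction.

The minimal `g` is a fusion limit: each stage freezes the values on the finitely many members inside
a finite set, and this set is kept ever after. -/

/-- Fusion: finite parts of the infinite sets attached to a decreasing sequence of conditions can be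
preserved along the sequence. -/
theorem exists_fusion {C : Type w} [Preorder C] (X : C → Set ℕ) (hX : Monotone X)
    (hinf : ∀ c, (X c).Infinite) (Φ : Finset ℕ → C → Prop)
    (step : ∀ c (F : Finset ℕ), (F : Set ℕ) ⊆ X c → ∃ c' ≤ c, (F : Set ℕ) ⊆ X c' ∧ Φ F c')
    (c₀ : C) :
    ∃ c : ℕ → C, Antitone c ∧ c 0 ≤ c₀ ∧ ∃ x : ℕ → ℕ, StrictMono x ∧ (∀ n m, x n ∈ X (c m)) ∧
      ∀ n, Φ ((Finset.range n).image x) (c n) := by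
  classical
  let St := {p : C × Finset ℕ // (p.2 : Set ℕ) ⊆ X p.1 ∧ Φ p.2 p.1}
  have next : ∀ p : St, ∃ q : St, ∃ y, (∀ z ∈ p.1.2, z < y) ∧ q.1.1 ≤ p.1.1 ∧
      q.1.2 = insert y p.1.2 := by
    rintro ⟨⟨c, F⟩, hF, -⟩
    obtain ⟨y, hy, hlt⟩ := (hinf c).exists_gt (F.sup id)
    obtain ⟨c', hc', hF', hΦ⟩ := step c (insert y F) (by
      intro z hz
      rcases Finset.mem_insert.1 hz with rfl | hz
      · exact hy
      · exact hF hz)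
    exact ⟨⟨⟨c', insert y F⟩, hF', hΦ⟩, y,
      fun z hz => (Finset.le_sup (f := id) hz).trans_lt hlt, hc', rfl⟩
  choose nx y hy hle hins using next
  obtain ⟨c₁, hc₁, h₁, h₁'⟩ := step c₀ ∅ (by simp)
  let q : ℕ → St := fun k => nx^[k] ⟨⟨c₁, ∅⟩, h₁, h₁'⟩
  have hq : ∀ k, q (k + 1) = nx (q k) := fun k => Function.iterate_succ_apply' _ _ _
  let x : ℕ → ℕ := fun k => y (q k)
  have hF : ∀ k, (q k).1.2 = (Finset.range k).image x := by
    intro k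
    induction k with
    | zero => rfl
    | succ k ih => rw [hq, hins, ih, Finset.range_add_one, Finset.image_insert]
  have hanti : Antitone fun k => (q k).1.1 := antitone_nat_of_succ_le fun k => by
    rw [hq]
    exact hle _
  have hmem : ∀ n m, n < m → x n ∈ X (q m).1.1 := fun n m h => (q m).2.1 (by
    rw [hF]
    exact Finset.mem_coe.2 (Finset.mem_image_of_mem _ (Finset.mem_range.2 h)))
  refine ⟨fun k => (q k).1.1, hanti, hc₁, x, strictMono_nat_of_lt_succ fun k => ?_,
    fun n m => ?_, fun n => ?_⟩
  · refine hy (q (k + 1)) _ ?_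
    rw [hF]
    exact Finset.mem_image_of_mem _ (Finset.mem_range.2 k.lt_succ_self)
  · rcases lt_or_ge n m with h | h
    · exact hmem n m h
    · exact hX (hanti (h.trans n.le_succ)) (hmem n (n + 1) n.lt_succ_self)
  · have := (q n).2.2
    rwa [hF] at this

/-- A nonempty finite subset of the range of an increasing sequence `x` is, for some `k`, contained
in the first `k + 1` values of `x` and contains the last of these. -/
theorem exists_subset_image_range {x : ℕ → ℕ} (hx : StrictMono x) {F : Finset ℕ}
    (hF : (F : Set ℕ) ⊆ range x) (hne : F.Nonempty) :
    ∃ k, x k ∈ F ∧ F ⊆ (Finset.range (k + 1)).image x := by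
  obtain ⟨k, hk⟩ := hF (F.max'_mem hne)
  refine ⟨k, hk ▸ F.max'_mem hne, fun y hy => ?_⟩
  obtain ⟨j, rfl⟩ := hF hy
  have : x j ≤ x k := hk ▸ F.le_max' _ hy
  exact Finset.mem_image_of_mem _ (Finset.mem_range.2 (Nat.lt_succ_of_le (hx.le_iff_le.1 this)))

/-- The elements of `X` beyond the finite set `F`. -/
def beyond (F : Finset ℕ) (X : Set ℕ) : Set ℕ := {y ∈ X | ∀ x ∈ F, x < y}

theorem beyond_infinite (F : Finset ℕ) {X : Set ℕ} (hX : X.Infinite) : (beyond F X).Infinite := by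
  refine Set.infinite_of_forall_exists_gt fun n => ?_
  obtain ⟨y, hy, hlt⟩ := hX.exists_gt (max n (F.sup id))
  exact ⟨y, ⟨hy, fun x hx => (Finset.le_sup (f := id) hx).trans_lt
    ((le_max_right _ _).trans_lt hlt)⟩, (le_max_left _ _).trans_lt hlt⟩

theorem beyond_subset (F : Finset ℕ) (X : Set ℕ) : beyond F X ⊆ X := fun _ h => h.1

theorem beyond_mono (F : Finset ℕ) {X Y : Set ℕ} (h : X ⊆ Y) : beyond F X ⊆ beyond F Y :=
  fun _ hy => ⟨h hy.1, hy.2⟩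

/-- Diagonalization of a hereditary property over the finite subsets of an infinite set. -/
theorem exists_diagonal (φ : Finset ℕ → Set ℕ → Prop)
    (anti : ∀ F X Y, Y ⊆ X → φ F X → φ F Y) {Z : Set ℕ} (hZ : Z.Infinite)
    (step : ∀ F X, X ⊆ Z → X.Infinite → ∃ Y ⊆ X, Y.Infinite ∧ φ F Y) :
    ∃ Y ⊆ Z, Y.Infinite ∧ ∀ F : Finset ℕ, (F : Set ℕ) ⊆ Y → φ F (beyond F Y) := by
  classical
  -- A fusion stage must treat all subsets of the current finite set at once.
  have step' : ∀ (𝒢 : Finset (Finset ℕ)) (X : Set ℕ), X ⊆ Z → X.Infinite →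
      ∃ Y ⊆ X, Y.Infinite ∧ ∀ G ∈ 𝒢, φ G Y := by
    intro 𝒢
    induction 𝒢 using Finset.induction_on with
    | empty => exact fun X _ hX => ⟨X, Subset.rfl, hX, by simp⟩
    | insert G 𝒢 _ ih =>
      intro X hXZ hX
      obtain ⟨Y, hYX, hY, h⟩ := ih X hXZ hX
      obtain ⟨Y', hY'Y, hY', h'⟩ := step G Y (hYX.trans hXZ) hY
      refine ⟨Y', hY'Y.trans hYX, hY', fun G' hG' => ?_⟩
      rcases Finset.mem_insert.1 hG' with rfl | hG'
      · exact h'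
      · exact anti _ _ _ hY'Y (h _ hG')
  obtain ⟨c, -, -, x, hx, hmem, hΦ⟩ := exists_fusion (C := {X : Set ℕ // X ⊆ Z ∧ X.Infinite})
    (fun X => X.1) (fun _ _ h => h) (fun X => X.2.2)
    (fun F X => ∀ G ⊆ F, φ G (beyond F X.1)) (by
      rintro ⟨X, hXZ, hX⟩ F hF
      obtain ⟨Y, hYX, hY, h⟩ := step' F.powerset (beyond F X) ((beyond_subset F X).trans hXZ)
        (beyond_infinite F hX)
      have hsub : (F : Set ℕ) ∪ Y ⊆ X := union_subset hF (hYX.trans (beyond_subset F X))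
      refine ⟨⟨F ∪ Y, hsub.trans hXZ, hY.mono subset_union_right⟩, hsub, subset_union_left,
        fun G hG => anti _ _ _ ?_ (h G (Finset.mem_powerset.2 hG))⟩
      rintro y ⟨hy | hy, hlt⟩
      · exact absurd (hlt y hy) (lt_irrefl y)
      · exact hy) ⟨Z, Subset.rfl, hZ⟩
  refine ⟨range x, ?_, infinite_range_of_injective hx.injective, fun F hF => ?_⟩
  · rintro _ ⟨n, rfl⟩
    exact (c 0).2.1 (hmem n 0)
  · have hsub : ∀ m, range x ⊆ (c m).1 := by
      rintro m _ ⟨n, rfl⟩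
      exact hmem n m
    rcases F.eq_empty_or_nonempty with rfl | hne
    · exact anti _ (beyond _ _) _ (fun y (hy : y ∈ beyond _ (range x)) => ⟨hsub 0 hy.1, by simp⟩)
        (hΦ 0 ∅ (by simp))
    -- Since `x k` is the last element of `F`, lying beyond `F` is lying beyond all of `x 0, …, x
    -- k`.
    · obtain ⟨k, hk, hFk⟩ := exists_subset_image_range hx hF hne
      refine anti _ (beyond _ _) _ (fun y (hy : y ∈ beyond _ (range x)) =>
        ⟨hsub _ hy.1, fun z hz => ?_⟩)
        (hΦ (k + 1) F hFk)
      obtain ⟨j, hj, rfl⟩ := Finset.mem_image.1 hz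
      exact (hx.monotone (Nat.le_of_lt_succ (Finset.mem_range.1 hj))).trans_lt (hy.2 _ hk)

/-! ### Galvin's partition theorem -/

/-- `X` accepts `s` if every infinite set that consists of `s` and elements of `X` beyond `s` has an
initial segment in `𝓕`. -/
def Accepts (𝓕 : Set (Finset ℕ)) (X : Set ℕ) (s : Finset ℕ) : Prop :=
  ∀ Y ⊆ beyond s X, Y.Infinite → ∃ r ∈ 𝓕, IsInitialSegment r (s ∪ Y)

/-- `X` rejects `s` if no infinite subset of `X` accepts `s`. -/
def Rejects (𝓕 : Set (Finset ℕ)) (X : Set ℕ) (s : Finset ℕ) : Prop :=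
  ∀ Y ⊆ X, Y.Infinite → ¬ Accepts 𝓕 Y s

theorem Accepts.mono {𝓕 : Set (Finset ℕ)} {X Y : Set ℕ} {s : Finset ℕ} (h : Accepts 𝓕 X s)
    (hYX : beyond s Y ⊆ X) : Accepts 𝓕 Y s :=
  fun Z hZ hZi => h Z (fun _ hz => ⟨hYX (hZ hz), (hZ hz).2⟩) hZi

/-- Galvin's theorem: for every family `𝓕` of finite sets, every infinite set has an infinite subset
`Y` such that every infinite subset of `Y` has an initial segment in `𝓕` or no finite subset of `Y`
is in `𝓕`. -/
theorem exists_galvin (𝓕 : Set (Finset ℕ)) {Z : Set ℕ} (hZ : Z.Infinite) :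
    ∃ Y ⊆ Z, Y.Infinite ∧ ((∀ X ⊆ Y, X.Infinite → ∃ r ∈ 𝓕, IsInitialSegment r X) ∨
      ∀ r ∈ 𝓕, ¬ (r : Set ℕ) ⊆ Y) := by
  classical
  obtain ⟨Y, hYZ, hY, hdec⟩ := exists_diagonal (fun F X => Accepts 𝓕 X F ∨ Rejects 𝓕 X F)
    (fun F X Y hYX h => h.imp (fun h => h.mono ((beyond_subset _ _).trans hYX))
      fun h W hW => h W (hW.trans hYX)) hZ
    (fun F X _ hX => by
      by_cases h : ∃ Y ⊆ X, Y.Infinite ∧ Accepts 𝓕 Y F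
      · obtain ⟨Y, h1, h2, h3⟩ := h
        exact ⟨Y, h1, h2, Or.inl h3⟩
      · exact ⟨X, Subset.rfl, hX, Or.inr fun Y h1 h2 h3 => h ⟨Y, h1, h2, h3⟩⟩)
  have hdec' : ∀ F : Finset ℕ, (F : Set ℕ) ⊆ Y → Accepts 𝓕 Y F ∨ Rejects 𝓕 Y F := by
    intro F hF
    refine (hdec F hF).imp (fun h => h.mono Subset.rfl) fun h W hWY hW hacc => ?_
    exact h (beyond F W) (beyond_mono F hWY) (beyond_infinite F hW)
      (hacc.mono ((beyond_subset _ _).trans (beyond_subset _ _)))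
  rcases hdec' ∅ (by simp) with hacc | hrej
  · refine ⟨Y, hYZ, hY, Or.inl fun X hXY hX => ?_⟩
    simpa using hacc X (fun x hx => ⟨hXY hx, by simp⟩) hX
  obtain ⟨W, hWY, hW, hW'⟩ := exists_diagonal
    (fun F X => (F : Set ℕ) ⊆ Y → Rejects 𝓕 Y F → ∀ n ∈ X, Rejects 𝓕 Y (insert n F))
    (fun F X X' hX' h h1 h2 n hn => h h1 h2 n (hX' hn)) hY
    (fun F X hXY hX => by
      by_cases hF : (F : Set ℕ) ⊆ Y ∧ Rejects 𝓕 Y F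
      swap
      · exact ⟨X, Subset.rfl, hX, fun h1 h2 => absurd ⟨h1, h2⟩ hF⟩
      obtain ⟨hFY, hF⟩ := hF
      -- If infinite, this set would accept `F`: for an infinite subset `U` with least element `n`,
      -- the set `F ∪ U` is `insert n F` followed by `U \ {n}`, and `insert n F` is accepted.
      have hfin : {n ∈ beyond F X | ¬ Rejects 𝓕 Y (insert n F)}.Finite := by
        by_contra hinf
        refine hF _ (fun n hn => hXY hn.1.1) hinf fun U hU hUi => ?_
        have hne := hUi.nonempty
        have hn := Nat.sInf_mem hne
        set n := sInf U
        obtain ⟨⟨⟨hnX, -⟩, hnr⟩, hnF⟩ := hU hn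
        have hacc := (hdec' (insert n F) (by
          intro z hz
          rcases Finset.mem_insert.1 hz with rfl | hz
          · exact hXY hnX
          · exact hFY hz)).resolve_right hnr
        obtain ⟨r, hr, hr'⟩ := hacc (U \ {n}) (by
          rintro z ⟨hz, hzn⟩
          refine ⟨hXY (hU hz).1.1.1, fun x hx => ?_⟩
          rcases Finset.mem_insert.1 hx with rfl | hx
          · exact lt_of_le_of_ne (Nat.sInf_le hz) (Ne.symm hzn)
          · exact (hU hz).2 x hx) (hUi.sdiff (finite_singleton n))
        refine ⟨r, hr, ?_⟩
        convert hr' using 1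
        ext z
        by_cases hz : z = n
        · simp [hz, hn]
        · simp [hz]
      refine ⟨beyond F X \ {n ∈ beyond F X | ¬ Rejects 𝓕 Y (insert n F)},
        sdiff_subset.trans (beyond_subset F X), (beyond_infinite F hX).sdiff hfin,
        fun _ _ n hn => ?_⟩
      by_contra h
      exact hn.2 ⟨hn.1, h⟩)
  refine ⟨W, hWY.trans hYZ, hW, Or.inr fun r hr hrW => ?_⟩
  have hall : ∀ F : Finset ℕ, (F : Set ℕ) ⊆ W → Rejects 𝓕 Y F := by
    intro F
    induction F using Finset.induction_on_max with
    | empty => exact fun _ => hrej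
    | insert n F hn ih =>
      intro h
      have hFW : (F : Set ℕ) ⊆ W := fun z hz => h (Finset.mem_insert_of_mem hz)
      exact hW' F hFW (hFW.trans hWY) (ih hFW) n ⟨h (Finset.mem_insert_self _ _), hn⟩
  -- A member of `𝓕` is accepted by every set, being itself the required initial segment.
  refine hall r hrW Y Subset.rfl hY fun U hU _ => ⟨r, hr, subset_union_left, ?_⟩
  rintro x (hx | hx) y hy hxy
  · exact hx
  · exact absurd ((hU hx).2 y hy) (not_lt.2 hxy)

/-! ### Subbarriers -/

/-- The members of `B` that are contained in `X`. -/
def restrict (B : Set (Finset ℕ)) (X : Set ℕ) : Set (Finset ℕ) := {s ∈ B | (s : Set ℕ) ⊆ X}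

theorem restrict_mono (B : Set (Finset ℕ)) {X Y : Set ℕ} (h : X ⊆ Y) :
    restrict B X ⊆ restrict B Y := fun _ hs => ⟨hs.1, hs.2.trans h⟩

theorem IsInitialSegment.subset_or_subset {r s : Finset ℕ} {X : Set ℕ} (hr : IsInitialSegment r X)
    (hs : IsInitialSegment s X) : r ⊆ s ∨ s ⊆ r := by
  by_contra! h
  obtain ⟨⟨x, hxr, hxs⟩, y, hys, hyr⟩ := Finset.not_subset.1 h.1, Finset.not_subset.1 h.2
  rcases le_total x y with hxy | hxy
  · exact hxs (hs.2 x (hr.1 hxr) y hys hxy)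
  · exact hyr (hr.2 y (hs.1 hys) x hxr hxy)

/-- Every element of `s` that is not in `r` exceeds all elements of `r`, if `r ◁ s`. -/
theorem ShiftExt.mem_or_lt {r s : Finset ℕ} (h : ShiftExt r s) {x : ℕ} (hx : x ∈ s) :
    x ∈ r ∨ ∀ y ∈ r, y < x := by
  obtain ⟨hr, hs, hlt, hini, -⟩ := h
  refine or_iff_not_imp_left.2 fun hxr y hy => ?_
  by_contra! hxy
  by_cases hy' : y = r.min' hr
  · exact absurd (hlt.trans_le (s.min'_le x hx)) (not_lt.2 (hy' ▸ hxy))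
  · exact hxr (Finset.mem_of_mem_erase
      (hini.2 x hx y (Finset.mem_coe.2 (Finset.mem_erase.2 ⟨hy', hy⟩)) hxy))

theorem ShiftExt.exists_forall_lt {r s : Finset ℕ} (h : ShiftExt r s) :
    ∃ x ∈ s, ∀ y ∈ r, y < x := by
  have hmem : ∀ {x}, x ∈ s → _ := h.mem_or_lt
  obtain ⟨hr, hs, hlt, hini, hne⟩ := h
  obtain ⟨x, hx, hxr⟩ : ∃ x ∈ s, x ∉ r.erase (r.min' hr) := by
    by_contra! hall
    exact hne (Finset.Subset.antisymm (fun x hx => hini.1 hx) hall)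
  refine ⟨x, hx, (hmem hx).resolve_left fun hx' => hxr (Finset.mem_erase.2 ⟨?_, hx'⟩)⟩
  exact (hlt.trans_le (s.min'_le x hx)).ne'

/-- With its companion for `s`, this recovers a pair `r ◁ s` of barrier members from `r ∪ s`, so
that Galvin's theorem for single finite sets applies to pairs. -/
theorem ShiftExt.isInitialSegment_left {r s : Finset ℕ} (h : ShiftExt r s) {X : Set ℕ}
    (hX : IsInitialSegment (r ∪ s) X) : IsInitialSegment r X := by
  refine ⟨fun x hx => hX.1 (Finset.mem_union_left _ hx), fun x hx y hy hxy => ?_⟩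
  rcases Finset.mem_union.1 (hX.2 x hx y (Finset.mem_union_left _ hy) hxy) with h' | h'
  · exact h'
  · exact (h.mem_or_lt h').resolve_right fun h'' => not_lt.2 hxy (h'' y hy)

theorem ShiftExt.isInitialSegment_right {r s : Finset ℕ} (h : ShiftExt r s) {X : Set ℕ}
    (hX : IsInitialSegment (r ∪ s) X) : IsInitialSegment s {x ∈ X | ∃ y ∈ r, y < x} := by
  obtain ⟨hr, hs, hlt, hini, -⟩ := h
  refine ⟨fun x hx => ⟨hX.1 (Finset.mem_union_right _ hx), _, r.min'_mem hr,
    hlt.trans_le (s.min'_le x hx)⟩, ?_⟩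
  rintro x ⟨hx, z, hz, hzx⟩ y hy hxy
  rcases Finset.mem_union.1 (hX.2 x hx y (Finset.mem_union_right _ hy) hxy) with h' | h'
  · exact hini.1 (Finset.mem_erase.2 ⟨((r.min'_le z hz).trans_lt hzx).ne', h'⟩)
  · exact h'

namespace IsBarrier

variable {B : Set (Finset ℕ)}

theorem nonempty_of_mem (hB : IsBarrier B) {s : Finset ℕ} (hs : s ∈ B) : s.Nonempty := by
  by_contra h
  rw [Finset.not_nonempty_iff_eq_empty] at h
  subst h
  refine hB.infinite ((finite_singleton (∅ : Finset ℕ)).subset fun t ht => ?_)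
  exact (hB.antichain _ hs t ht (Finset.empty_subset t)).symm

theorem eq_of_isInitialSegment (hB : IsBarrier B) {s t : Finset ℕ} (hs : s ∈ B) (ht : t ∈ B)
    {X : Set ℕ} (hsX : IsInitialSegment s X) (htX : IsInitialSegment t X) : s = t :=
  (hsX.subset_or_subset htX).elim (hB.antichain s hs t ht)
    fun h => (hB.antichain t ht s hs h).symm

theorem restrict_nonempty (hB : IsBarrier B) {X : Set ℕ} (hXB : X ⊆ base B) (hX : X.Infinite) :
    (restrict B X).Nonempty := by
  obtain ⟨s, hs, hsX⟩ := hB.exists_initialSegment X hXB hX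
  exact ⟨s, hs, hsX.1⟩

/-- The members of a barrier contained in an infinite subset of its base form a barrier. -/
theorem isBarrier_restrict (hB : IsBarrier B) {X : Set ℕ} (hXB : X ⊆ base B) (hX : X.Infinite) :
    IsBarrier (restrict B X) where
  infinite hfin := by
    -- A member lying beyond the union of all the finitely many members is still one of them.
    obtain ⟨s, hs, hsX⟩ := hB.restrict_nonempty ((beyond_subset (hfin.toFinset.sup id) X).trans hXB)
      (beyond_infinite _ hX)
    obtain ⟨x, hx⟩ := hB.nonempty_of_mem hs
    have hsup : s ⊆ hfin.toFinset.sup id := Finset.le_sup (f := id)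
      (hfin.mem_toFinset.2 ⟨hs, hsX.trans (beyond_subset _ _)⟩)
    exact lt_irrefl x ((hsX hx).2 x (hsup hx))
  antichain s hs t ht := hB.antichain s hs.1 t ht.1
  exists_initialSegment Y hYB hY := by
    have hYX : Y ⊆ X := hYB.trans (iUnion₂_subset fun s hs => hs.2)
    obtain ⟨s, hs, hsY⟩ := hB.exists_initialSegment Y (hYX.trans hXB) hY
    exact ⟨s, ⟨hs, hsY.1.trans hYX⟩, hsY⟩

theorem orderType_mono (hB : IsBarrier B) {A : Set (Finset ℕ)} (hA : IsBarrier A) (h : A ⊆ B) :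
    hA.orderType ≤ hB.orderType := by
  have := hA.isWellOrder
  have := hB.isWellOrder
  exact Ordinal.type_le_iff'.2 ⟨⟨⟨fun s => ⟨s.1, h s.2⟩, fun s t hst =>
    Subtype.ext (congrArg (fun u : B => u.1) hst)⟩, Iff.rfl⟩⟩

/-- Drop the minimum of `s` and continue with elements of `X` beyond `s`. The barrier member
starting this set cannot stop inside `s`, by the antichain condition. -/
theorem exists_shiftExt (hB : IsBarrier B) {X : Set ℕ} (hXB : X ⊆ base B) (hX : X.Infinite)
    {s : Finset ℕ} (hs : s ∈ restrict B X) : ∃ t ∈ restrict B X, ShiftExt s t := by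
  have hne := hB.nonempty_of_mem hs.1
  set m := s.min' hne
  have hYX : (s.erase m : Set ℕ) ∪ beyond s X ⊆ X :=
    union_subset (fun x hx => hs.2 (Finset.mem_of_mem_erase hx)) (beyond_subset s X)
  have hmY : ∀ y ∈ (s.erase m : Set ℕ) ∪ beyond s X, m < y := by
    rintro y (hy | hy)
    · exact s.min'_lt_of_mem_erase_min' hne hy
    · exact hy.2 m (s.min'_mem hne)
  have hini : IsInitialSegment (s.erase m) ((s.erase m : Set ℕ) ∪ beyond s X) := by
    refine ⟨subset_union_left, ?_⟩
    rintro x (hx | hx) y hy hxy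
    · exact hx
    · exact absurd (hx.2 y (Finset.mem_of_mem_erase hy)) (not_lt.2 hxy)
  obtain ⟨t, ht, htY⟩ := hB.exists_initialSegment _ (hYX.trans hXB)
    ((beyond_infinite s hX).mono subset_union_right)
  have hts : ¬ t ⊆ s.erase m := fun h => by
    have := hB.antichain t ht s hs.1 (h.trans (s.erase_subset m))
    exact s.notMem_erase m (h (this ▸ s.min'_mem hne))
  refine ⟨t, ⟨ht, htY.1.trans hYX⟩, hne, hB.nonempty_of_mem ht,
    hmY _ (htY.1 (t.min'_mem _)), ⟨(hini.subset_or_subset htY).resolve_right hts, ?_⟩,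
    fun h => hts h.ge⟩
  exact fun x hx y hy => hini.2 x (htY.1 hx) y hy

end IsBarrier

/-! ### Bad and perfect barrier sequences -/

/-- `f` is bad on the members of `B` contained in `X`. -/
def BadOn {Q : Type u} [Preorder Q] (B : Set (Finset ℕ)) (X : Set ℕ) (f : Finset ℕ → Q) : Prop :=
  ∀ s ∈ restrict B X, ∀ t ∈ restrict B X, ShiftExt s t → ¬ f s ≤ f t

/-- `f` is perfect on the members of `B` contained in `X`. -/
def PerfectOn {Q : Type u} [Preorder Q] (B : Set (Finset ℕ)) (X : Set ℕ) (f : Finset ℕ → Q) :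
    Prop :=
  ∀ s ∈ restrict B X, ∀ t ∈ restrict B X, ShiftExt s t → f s ≤ f t

section

variable {Q : Type u} [Preorder Q] {B : Set (Finset ℕ)}

/-- Every barrier sequence is bad or perfect on a subbarrier. -/
theorem IsBarrier.exists_bad_or_perfect (hB : IsBarrier B) {X : Set ℕ}
    (hX : X.Infinite) (f : Finset ℕ → Q) :
    ∃ Y ⊆ X, Y.Infinite ∧ (BadOn B Y f ∨ PerfectOn B Y f) := by
  classical
  obtain ⟨Y, hYX, hY, h⟩ := exists_galvin
    {r | ∃ s ∈ B, ∃ t ∈ B, ShiftExt s t ∧ f s ≤ f t ∧ s ∪ t = r} hX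
  refine ⟨Y, hYX, hY, ?_⟩
  rcases h with h | h
  swap
  · refine Or.inl fun s hs t ht hst hle => h (s ∪ t) ⟨s, hs.1, t, ht.1, hst, hle, rfl⟩ ?_
    rw [Finset.coe_union]
    exact union_subset hs.2 ht.2
  right
  intro s hs t ht hst
  have hstY : ((s ∪ t : Finset ℕ) : Set ℕ) ⊆ Y := by
    rw [Finset.coe_union]
    exact union_subset hs.2 ht.2
  have hunion : IsInitialSegment (s ∪ t) ((s ∪ t : Finset ℕ) ∪ beyond (s ∪ t) Y : Set ℕ) := by
    refine ⟨subset_union_left, ?_⟩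
    rintro x (hx | hx) y hy hxy
    · exact hx
    · exact absurd (hx.2 y hy) (not_lt.2 hxy)
  obtain ⟨_, ⟨s', hs', t', ht', hst', hle, rfl⟩, hW⟩ := h _
    (union_subset hstY (beyond_subset (s ∪ t) Y))
    ((beyond_infinite (s ∪ t) hY).mono subset_union_right)
  obtain rfl := hB.eq_of_isInitialSegment hs.1 hs' (hst.isInitialSegment_left hunion)
    (hst'.isInitialSegment_left hW)
  obtain rfl := hB.eq_of_isInitialSegment ht.1 ht' (hst.isInitialSegment_right hunion)
    (hst'.isInitialSegment_right hW)
  exact hle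

end

/-! ### Minimal bad barrier sequences -/

section

variable {Q : Type u} [Preorder Q] {B : Set (Finset ℕ)}

/-- `x` is equal to `y` or below `y` with a smaller value of `ℓ`. -/
def RankLE (ℓ : Q → Ordinal.{v}) (x y : Q) : Prop := x = y ∨ x ≤ y ∧ ℓ x < ℓ y

theorem RankLE.le {ℓ : Q → Ordinal.{v}} {x y : Q} (h : RankLE ℓ x y) : x ≤ y :=
  h.elim (fun h => h ▸ le_rfl) fun h => h.1

theorem RankLE.rank_le {ℓ : Q → Ordinal.{v}} {x y : Q} (h : RankLE ℓ x y) : ℓ x ≤ ℓ y :=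
  h.elim (fun h => h ▸ le_rfl) fun h => h.2.le

theorem RankLE.trans {ℓ : Q → Ordinal.{v}} {x y z : Q} (h : RankLE ℓ x y) (h' : RankLE ℓ y z) :
    RankLE ℓ x z := by
  rcases h with rfl | ⟨h1, h2⟩
  · exact h'
  · exact Or.inr ⟨h1.trans h'.le, h2.trans_le h'.rank_le⟩

/-- A bad barrier sequence on the members of `B` contained in an infinite set. -/
structure BadArray (B : Set (Finset ℕ)) (Q : Type u) [Preorder Q] where
  carrier : Set ℕ
  infinite : carrier.Infinite
  toFun : Finset ℕ → Q
  bad : BadOn B carrier toFun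

/-- The bad barrier sequences, preordered by restriction combined with `RankLE`. -/
@[reducible] def BadArray.preorder (B : Set (Finset ℕ)) (ℓ : Q → Ordinal.{v}) :
    Preorder (BadArray B Q) where
  le c d := c.carrier ⊆ d.carrier ∧
    ∀ u ∈ restrict B c.carrier, RankLE ℓ (c.toFun u) (d.toFun u)
  le_refl _ := ⟨Subset.rfl, fun _ _ => Or.inl rfl⟩
  le_trans _ _ _ h h' := ⟨h.1.trans h'.1, fun u hu =>
    (h.2 u hu).trans (h'.2 u (restrict_mono B h.1 hu))⟩

/-- Below every bad barrier sequence there is one, on a subbarrier of the same barrier, whose values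
cannot all be lowered in rank on a further subbarrier. -/
theorem IsBarrier.exists_minimal_bad (hB : IsBarrier B) (ℓ : Q → Ordinal.{v}) {X : Set ℕ}
    (hXB : X ⊆ base B) (hX : X.Infinite) {f : Finset ℕ → Q} (hf : BadOn B X f) :
    ∃ Y ⊆ X, Y.Infinite ∧ ∃ g : Finset ℕ → Q, BadOn B Y g ∧
      ∀ Z ⊆ Y, Z.Infinite → ∀ h : Finset ℕ → Q,
        (∀ u ∈ restrict B Z, h u ≤ g u ∧ ℓ (h u) < ℓ (g u)) → ¬ BadOn B Z h := by
  classical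
  let _ := BadArray.preorder B ℓ
  obtain ⟨c, hc, hc₀, x, hx, hmem, hΦ⟩ := exists_fusion (C := BadArray B Q)
    BadArray.carrier (fun _ _ h => And.left h) BadArray.infinite
    (fun F c => ∀ c' ≤ c, (F : Set ℕ) ⊆ c'.carrier → ∀ u ∈ B, u ⊆ F →
      ¬ ℓ (c'.toFun u) < ℓ (c.toFun u)) (by
      intro c F hF
      -- A finite product of well-founded orders is well founded, so all these ranks can be
      -- minimized together.
      let rk : BadArray B Q → {u // u ∈ F.powerset.filter (· ∈ B)} → Ordinal.{v} :=
        fun c u => ℓ (c.toFun u)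
      let S : Set (BadArray B Q) := {c' | c' ≤ c ∧ (F : Set ℕ) ⊆ c'.carrier}
      obtain ⟨d, ⟨hdc, hdF⟩, hmin⟩ := (InvImage.wf rk wellFounded_lt).has_min S ⟨c, le_rfl, hF⟩
      refine ⟨d, hdc, hdF, fun c' hc' hF' u hu huF hlt => ?_⟩
      refine hmin c' ⟨hc'.trans hdc, hF'⟩ (Pi.lt_def.2 ⟨fun v => ?_, ⟨u, by simp [hu, huF]⟩, hlt⟩)
      obtain ⟨v, hv⟩ := v
      simp only [Finset.mem_filter, Finset.mem_powerset] at hv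
      exact (hc'.2 v ⟨hv.2, (Finset.coe_subset.2 hv.1).trans hF'⟩).rank_le)
    ⟨X, hX, f, hf⟩
  set F : ℕ → Finset ℕ := fun n => (Finset.range n).image x
  have hsub : ∀ m, range x ⊆ (c m).carrier := by
    rintro m _ ⟨n, rfl⟩
    exact hmem n m
  have hFx : ∀ n, (F n : Set ℕ) ⊆ range x := fun n => by simp [F]
  have hFmono : ∀ {m n}, m ≤ n → F m ⊆ F n := fun h =>
    Finset.image_subset_image (Finset.range_mono h)
  have hex : ∀ u ∈ restrict B (range x), ∃ k, x k ∈ u ∧ u ⊆ F (k + 1) := fun u hu =>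
    exists_subset_image_range hx hu.2 (hB.nonempty_of_mem hu.1)
  -- In `RankLE` a value either stays the same or drops in rank, and `hΦ` excludes a drop.
  have hstab : ∀ {m n}, m ≤ n → ∀ u ∈ B, u ⊆ F m → (c n).toFun u = (c m).toFun u := by
    intro m n hmn u hu hum
    have hu' := ((Finset.coe_subset.2 hum).trans (hFx m)).trans (hsub n)
    refine ((hc hmn).2 u ⟨hu, hu'⟩).resolve_right fun h => hΦ m (c n) (hc hmn) ((hFx m).trans (hsub n)) u hu hum h.2
  let g : Finset ℕ → Q := fun u => if h : ∃ n, u ⊆ F n then (c (Nat.find h)).toFun u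
    else (c 0).toFun u
  have hg : ∀ n, ∀ u ∈ B, u ⊆ F n → g u = (c n).toFun u := by
    intro n u hu hun
    have h : ∃ n, u ⊆ F n := ⟨n, hun⟩
    simp only [g, dif_pos h]
    exact (hstab (Nat.find_min' h hun) u hu (Nat.find_spec h)).symm
  have hgc : ∀ n, ∀ u ∈ restrict B (range x), RankLE ℓ (g u) ((c n).toFun u) := by
    intro n u hu
    obtain ⟨k, -, hk⟩ := hex u hu
    rw [hg (max n (k + 1)) u hu.1 (hk.trans (hFmono (le_max_right _ _)))]
    exact (hc (le_max_left _ _)).2 u ⟨hu.1, hu.2.trans (hsub _)⟩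
  have hgbad : BadOn B (range x) g := by
    intro s hs t ht hst
    obtain ⟨i, -, hi⟩ := hex s hs
    obtain ⟨j, -, hj⟩ := hex t ht
    rw [hg (max (i + 1) (j + 1)) s hs.1 (hi.trans (hFmono (le_max_left _ _))),
      hg (max (i + 1) (j + 1)) t ht.1 (hj.trans (hFmono (le_max_right _ _)))]
    exact (c _).bad s ⟨hs.1, hs.2.trans (hsub _)⟩ t ⟨ht.1, ht.2.trans (hsub _)⟩ hst
  refine ⟨range x, (hsub 0).trans hc₀.1, infinite_range_of_injective hx.injective, g, hgbad,
    fun Z hZ hZi h hlow hbad => ?_⟩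
  have hxB : range x ⊆ base B := ((hsub 0).trans hc₀.1).trans hXB
  obtain ⟨s, hs⟩ := hB.restrict_nonempty (hZ.trans hxB) hZi
  obtain ⟨k, hk, hsk⟩ := hex s (restrict_mono B hZ hs)
  -- To contradict `hΦ (k + 1)` the carrier must retain `F (k + 1)`, so `g` is lowered only at
  -- members of `Z` reaching `x k`. If `u` is such a member and `u ◁ t`, then so is `t`: its new
  -- elements exceed `x k`, hence avoid `F (k + 1)`.
  let h' : Finset ℕ → Q := fun u => if (u : Set ℕ) ⊆ Z ∧ ∃ z ∈ u, x k ≤ z then h u else g u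
  have hh'g : ∀ u ∈ B, RankLE ℓ (h' u) (g u) := by
    intro u hu
    by_cases hu' : (u : Set ℕ) ⊆ Z ∧ ∃ z ∈ u, x k ≤ z
    · simp only [h', if_pos hu']
      exact Or.inr (hlow u ⟨hu, hu'.1⟩)
    · simp only [h', if_neg hu']
      exact Or.inl rfl
  have hWx : (F (k + 1) : Set ℕ) ∪ Z ⊆ range x := union_subset (hFx _) hZ
  have hh'bad : BadOn B ((F (k + 1) : Set ℕ) ∪ Z) h' := by
    intro u hu t ht hut hle
    by_cases hu' : (u : Set ℕ) ⊆ Z ∧ ∃ z ∈ u, x k ≤ z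
    · obtain ⟨huZ, z, hz, hkz⟩ := hu'
      have ht' : (t : Set ℕ) ⊆ Z ∧ ∃ z ∈ t, x k ≤ z := by
        constructor
        · intro y hy
          rcases hut.mem_or_lt hy with hyu | hyu
          · exact huZ hyu
          · refine (ht.2 hy).resolve_left fun hyF => ?_
            obtain ⟨j, hj, rfl⟩ := Finset.mem_image.1 (Finset.mem_coe.1 hyF)
            have := hx.monotone (Nat.le_of_lt_succ (Finset.mem_range.1 hj))
            exact absurd (hyu z hz) (not_lt.2 (this.trans hkz))
        · obtain ⟨y, hy, hyu⟩ := hut.exists_forall_lt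
          exact ⟨y, hy, hkz.trans (hyu z hz).le⟩
      simp only [h', if_pos ht', if_pos (show (u : Set ℕ) ⊆ Z ∧ ∃ z ∈ u, x k ≤ z from
        ⟨huZ, z, hz, hkz⟩)] at hle
      exact hbad u ⟨hu.1, huZ⟩ t ⟨ht.1, ht'.1⟩ hut hle
    · simp only [h', if_neg hu'] at hle
      exact hgbad u (restrict_mono B hWx hu) t (restrict_mono B hWx ht) hut
        (hle.trans (hh'g t ht.1).le)
  refine hΦ (k + 1) ⟨_, hZi.mono subset_union_right, h', hh'bad⟩
    ⟨hWx.trans (hsub _), fun u hu => (hh'g u hu.1).trans (hgc _ u (restrict_mono B hWx hu))⟩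
    subset_union_left s hs.1 hsk ?_
  rw [← hg (k + 1) s hs.1 hsk]
  simp only [h', if_pos (show (s : Set ℕ) ⊆ Z ∧ ∃ z ∈ s, x k ≤ z from ⟨hs.2, _, hk, le_rfl⟩)]
  exact (hlow s hs).2

end

/-! ### Sequences of ordinal length -/

section

variable {P : Type u} [PartialOrder P]

/-- The sequence `f` of length smaller than `α`, extended by the constant value `a`. -/
noncomputable def OrdSeqLT.pad {α : Ordinal.{v}} (f : OrdSeqLT P α) (a : P) : OrdSeq P α :=
  open Classical in ⟨fun i => if h : i.1 < f.length then f.toFun ⟨i, h⟩ else a⟩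

/-- The restriction of `f` to `β`. -/
def OrdSeqLT.take {α : Ordinal.{v}} (f : OrdSeqLT P α) (β : Ordinal.{v}) (h : β < f.length) :
    OrdSeqLT P α :=
  ⟨β, h.trans f.length_lt, fun i => f.toFun ⟨i, lt_trans i.2 h⟩⟩

theorem OrdSeqLT.take_le {α : Ordinal.{v}} (f : OrdSeqLT P α) {β : Ordinal.{v}}
    (h : β < f.length) : f.take β h ≤ f :=
  ⟨fun i => ⟨i, lt_trans i.2 h⟩, fun _ _ hij => hij, fun _ => le_rfl⟩

/-- If `f` extended by `a` embeds into `g` extended by `a` but `f` does not embed into `g`, then a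
tail of `f` is bounded by `a`. -/
theorem OrdSeqLT.exists_tail_le {α : Ordinal.{v}} {f g : OrdSeqLT P α} {a : P}
    (h : f.pad a ≤ g.pad a) (hfg : ¬ f ≤ g) :
    ∃ β < f.length, ∀ i : Iio f.length, β ≤ i.1 → f.toFun i ≤ a := by
  obtain ⟨ρ, hρ, hle⟩ := h
  by_contra! hcon
  refine hfg ?_
  -- Once `ρ` enters the padding it stays there, which would bound a tail of `f` by `a`.
  have hlt : ∀ i : Iio f.length, (ρ ⟨i, lt_trans i.2 f.length_lt⟩).1 < g.length := by
    intro i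
    by_contra! hi
    obtain ⟨j, hij, hj⟩ := hcon i i.2
    refine hj ?_
    have h1 := hle ⟨j, lt_trans j.2 f.length_lt⟩
    have h2 : ¬ (ρ ⟨j, lt_trans j.2 f.length_lt⟩).1 < g.length :=
      not_lt.2 (hi.trans (hρ.monotone (a := ⟨i, lt_trans i.2 f.length_lt⟩)
        (b := ⟨j, lt_trans j.2 f.length_lt⟩) hij))
    simpa [OrdSeqLT.pad, dif_neg h2, dif_pos (mem_Iio.1 j.2)] using h1
  refine ⟨fun i => ⟨_, hlt i⟩, fun i j hij => hρ (a := ⟨i, lt_trans i.2 f.length_lt⟩)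
        (b := ⟨j, lt_trans j.2 f.length_lt⟩) hij, fun i => ?_⟩
  have h1 := hle ⟨i, lt_trans i.2 f.length_lt⟩
  simpa [OrdSeqLT.pad, dif_pos (mem_Iio.1 i.2), dif_pos (hlt i)] using h1

/-- Concatenating constant tails of the same letter to comparable sequences. -/
theorem OrdSeqLT.le_of_take_le {α : Ordinal.{v}} {f g : OrdSeqLT P α} {a : P} {β γ : Ordinal.{v}}
    (hβ : β < f.length) (hγ : γ < g.length)
    (hf : ∀ i : Iio f.length, β ≤ i.1 → f.toFun i = a)
    (hg : ∀ i : Iio g.length, γ ≤ i.1 → g.toFun i = a)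
    (hle : f.take β hβ ≤ g.take γ hγ) (hlen : f.length - β ≤ g.length - γ) : f ≤ g := by
  classical
  obtain ⟨ρ, hρ, h⟩ := hle
  have htail : ∀ i : Iio f.length, β ≤ i.1 → γ + (i.1 - β) < g.length := by
    intro i hi
    refine Ordinal.lt_sub.1 (lt_of_lt_of_le ?_ hlen)
    rw [Ordinal.lt_sub, Ordinal.add_sub_cancel_of_le hi]
    exact i.2
  -- On the tail, position `β + ξ` goes to `γ + ξ`.
  refine ⟨fun i => if hi : i.1 < β then ⟨(ρ ⟨i, hi⟩).1, lt_trans (ρ ⟨i, hi⟩).2 hγ⟩ else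
    ⟨γ + (i.1 - β), htail i (not_lt.1 hi)⟩, fun i j hij => ?_, fun i => ?_⟩
  · have hij' : i.1 < j.1 := hij
    by_cases hj : j.1 < β
    · have hi : i.1 < β := hij'.trans hj
      simp only [dif_pos hi, dif_pos hj]
      exact hρ (a := ⟨i, hi⟩) (b := ⟨j, hj⟩) hij
    · by_cases hi : i.1 < β
      · simp only [dif_pos hi, dif_neg hj]
        exact Subtype.mk_lt_mk.2 ((ρ ⟨i, hi⟩).2.trans_le le_self_add)
      · simp only [dif_neg hi, dif_neg hj]
        refine Subtype.mk_lt_mk.2 (add_lt_add_right ?_ γ)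
        rw [Ordinal.lt_sub, Ordinal.add_sub_cancel_of_le (not_lt.1 hi)]
        exact hij'
  · by_cases hi : i.1 < β
    · simp only [dif_pos hi]
      exact h ⟨i, hi⟩
    · simp only [dif_neg hi]
      rw [hf i (not_lt.1 hi), hg _ le_self_add]

end

/-- A poset without bad sequences over some barrier is well founded. -/
theorem wellFoundedLT_of_not_badOn {P : Type u} [PartialOrder P] {B : Set (Finset ℕ)}
    (hgood : ∀ f : Finset ℕ → P, ¬ BadOn B (base B) f) : WellFoundedLT P := by
  refine ⟨RelEmbedding.wellFounded_iff_isEmpty.2 ⟨fun p => ?_⟩⟩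
  have hp : StrictAnti p := fun i j hij => p.map_rel_iff.2 hij
  -- Minima increase along `◁`, so a descending sequence indexed by minima is bad.
  refine hgood (fun s => p (sInf (s : Set ℕ))) fun s _ t _ ⟨hs, ht, hlt, _⟩ hle => ?_
  rw [← hs.csInf_eq_min', ← ht.csInf_eq_min'] at hlt
  exact (hp hlt).not_ge hle

/-- If every barrier sequence in `P^α` over a subbarrier of `B` is good, the same holds for the
sequences of length smaller than `α`. -/
theorem IsBarrier.not_badOn_ordSeqLT {P : Type u} [PartialOrder P] {α : Ordinal.{v}}
    {B : Set (Finset ℕ)} (hB : IsBarrier B)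
    (hgood : ∀ X ⊆ base B, X.Infinite → ∀ g : Finset ℕ → OrdSeq P α, ¬ BadOn B X g)
    (f : Finset ℕ → OrdSeqLT P α) : ¬ BadOn B (base B) f := by
  intro hf
  have hbase : (base B).Infinite := by
    intro hfin
    refine hB.infinite ((hfin.toFinset.powerset.finite_toSet).subset fun s hs => ?_)
    rw [Finset.mem_coe, Finset.mem_powerset]
    exact fun x hx => hfin.mem_toFinset.2 (mem_biUnion hs hx)
  obtain ⟨X, hXB, hX, g, hg, hmin⟩ := hB.exists_minimal_bad OrdSeqLT.length Subset.rfl hbase hf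
  have hpos : ∀ s ∈ restrict B X, 0 < (g s).length := by
    intro s hs
    obtain ⟨t, ht, hst⟩ := hB.exists_shiftExt hXB hX hs
    by_contra! h0
    have hemp : IsEmpty (Iio (g s).length) := ⟨fun i => not_lt.2 (h0.trans (zero_le)) i.2⟩
    exact hg s hs t ht hst ⟨fun i => hemp.elim i, fun i => hemp.elim i, fun i => hemp.elim i⟩
  have hα : 0 < α := (zero_le).trans_lt (g ∅).length_lt
  have hwf : WellFoundedLT P := wellFoundedLT_of_not_badOn (B := B) fun p hp => by
    refine hgood _ Subset.rfl hbase (fun s => ⟨fun _ => p s⟩) fun s hs t ht hst hle => ?_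
    obtain ⟨ρ, -, hρ⟩ := hle
    exact hp s hs t ht hst (hρ ⟨0, hα⟩)
  obtain ⟨s₀, hs₀⟩ := hB.restrict_nonempty hXB hX
  obtain ⟨b, -, hb⟩ := hwf.wf.has_min
    {p | ∃ s ∈ restrict B X, ∃ i, (g s).toFun i = p} ⟨_, s₀, hs₀, ⟨0, hpos s₀ hs₀⟩, rfl⟩
  obtain ⟨Y, hYX, hY, hpad⟩ := hB.exists_bad_or_perfect hX fun s => (g s).pad b
  replace hpad := hpad.resolve_left (hgood Y (hYX.trans hXB) hY _)
  have htail : ∀ s ∈ restrict B Y, ∃ β < (g s).length,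
      ∀ i : Iio (g s).length, β ≤ i.1 → (g s).toFun i = b := by
    intro s hs
    obtain ⟨t, ht, hst⟩ := hB.exists_shiftExt (hYX.trans hXB) hY hs
    obtain ⟨β, hβ, h⟩ := OrdSeqLT.exists_tail_le (hpad s hs t ht hst)
      (hg s (restrict_mono B hYX hs) t (restrict_mono B hYX ht) hst)
    refine ⟨β, hβ, fun i hi => (h i hi).eq_or_lt.resolve_right ?_⟩
    exact hb _ ⟨s, restrict_mono B hYX hs, i, rfl⟩
  choose! β hβ hβb using htail
  classical
  let k : Finset ℕ → OrdSeqLT P α := fun s =>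
    if h : β s < (g s).length then (g s).take (β s) h else g s
  have hk : ∀ s (hs : s ∈ restrict B Y), k s = (g s).take (β s) (hβ s hs) := fun s hs =>
    dif_pos (hβ s hs)
  obtain ⟨Z, hZY, hZ, hkZ⟩ := hB.exists_bad_or_perfect hY k
  replace hkZ := hkZ.resolve_left (hmin Z (hZY.trans hYX) hZ k fun s hs => by
    rw [hk s (restrict_mono B hZY hs)]
    exact ⟨OrdSeqLT.take_le _ _, hβ s (restrict_mono B hZY hs)⟩)
  have hZB := (hZY.trans hYX).trans hXB
  obtain ⟨s, hs, hmins⟩ := (InvImage.wf (fun s => (g s).length - β s)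
    (wellFounded_lt (α := Ordinal.{v}))).has_min _ (hB.restrict_nonempty hZB hZ)
  obtain ⟨t, ht, hst⟩ := hB.exists_shiftExt hZB hZ hs
  have hsY := restrict_mono B hZY hs
  have htY := restrict_mono B hZY ht
  refine hg s (restrict_mono B hYX hsY) t (restrict_mono B hYX htY) hst ?_
  refine OrdSeqLT.le_of_take_le (hβ s hsY) (hβ t htY) (hβb s hsY) (hβb t htY) ?_
    (not_lt.1 (hmins t ht))
  have := hkZ s hs t ht hst
  rwa [hk s hsY, hk t htY] at this

end BarrierWqo

/-- Subbarriers have no larger order type, so goodness of `P^α` holds on every subbarrier of `B`.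
What remains is passing between quotients and representatives. -/
theorem mainTheorem3 {P : Type*} [PartialOrder P] (α : Ordinal) (ε : Ordinal.{0})
    (hε : ε ∈ Set.Ico Ordinal.omega0 (Ordinal.omega 1))
    (h : BarrierWqo.IsOrdinalWqo ε (BarrierWqo.Power P α)) :
    BarrierWqo.IsOrdinalWqo ε (BarrierWqo.PowerLT P α) := by
  classical
  intro B hB hBε f
  by_contra hf
  obtain ⟨s₀, hs₀⟩ := hB.infinite.nonempty
  refine hB.not_badOn_ordSeqLT (α := α) (P := P) (fun X hXB hX g hg => ?_)
    (fun s => if hs : s ∈ B then ofAntisymmetrization (· ≤ ·) (f ⟨s, hs⟩) else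
      ofAntisymmetrization (· ≤ ·) (f ⟨s₀, hs₀⟩)) fun s hs t ht hst hle => ?_
  · have hBX := hB.isBarrier_restrict hXB hX
    obtain ⟨s, t, hst, hle⟩ := h _ hBX ((hB.orderType_mono hBX fun s hs => hs.1).trans hBε)
      fun s => toAntisymmetrization (· ≤ ·) (g s)
    exact hg s s.2 t t.2 hst (toAntisymmetrization_le_toAntisymmetrization_iff.1 hle)
  · simp only [dif_pos hs.1, dif_pos ht.1] at hle
    exact hf ⟨⟨s, hs.1⟩, ⟨t, ht.1⟩, hst, ofAntisymmetrization_le_ofAntisymmetrization_iff.1 hle⟩
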